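/- A tree is a partially ordered set $T$ such that $t^{\downarrow}=\{s\in T: s<t\}$ is well-ordered for every $t\in T$. The height of $t$ is the order type of $t^{\downarrow}$, the level $T_\alpha$ is the set of nodes of height $\alpha$, the height of $T$ is the least $\alpha$ with $T_\alpha=\emptyset$, and for $\xi$ below the height of $t$, $t\upharpoonright\xi$ is the unique predecessor of $t$ of height $\xi$. An $\aleph_1$-tree is a tree of height $\omega_1$ with countable levels; an antichain is a set of pairwise incomparable nodes; a Suslin tree is an $\aleph_1$-tree with no uncountable chains and no uncountable antichains. A subtree of a tree $T$ of height $\omega_1$ is a nonempty downward closed $S\subseteq T$ such that every $s\in S$ has extensions in $S$ of arbitrarily large height below $\omega_1$. A ladder system is a sequence $\mathbf C=(C_\alpha)$, indexed by the limit ordinals $0<\alpha<\omega_1$, where $C_\alpha$ is a cofinal subset of $\alpha$ of order type $\omega$. A $2$-colouring of $\mathbf C$ is a sequence $\mathbf f=(f_\alpha)$ of maps $f_\alpha:C_\alpha\to 2$; it is monochromatic if each $f_\alpha$ is constant. A $T$-uniformization of $\mathbf f$ is a map $\varphi$ (with values in $\omega$) on a subtree $S$ of $T$ such that for every $s\in S$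 of limit height $\alpha<\omega_1$, $\varphi(s\upharpoonright\xi)=f_\alpha(\xi)$ for all but finitely many $\xi\in C_\alpha$. The weak diamond $\Phi^2_{\omega_1}$ says: for every $F:2^{<\omega_1}\to 2$ there is $g\in 2^{\omega_1}$ such that for every $f\in 2^{\omega_1}$ the set $\{\alpha<\omega_1: g(\alpha)\ne F(f\upharpoonright\alpha)\}$ is stationary. Theorem. (1) $\Phi^2_{\omega_1}$ holds if and only if $2^{\aleph_0}<2^{\aleph_1}$. (2) If $\Phi^2_{\omega_1}$ holds, then for every $\aleph_1$-tree $T$ with no uncountable antichains and every ladder system $\mathbf C$ there is a monochromatic $2$-colouring of $\mathbf C$ with no $T$-uniformization. (3) In particular, if CH holds (that is, $2^{\aleph_0}=\aleph_1$), then for every Suslin tree $T$ and every ladder system $\mathbf C$ there is a monochromatic $2$-colouring of $\mathbf C$ with no $T$-uniformization. -/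

import Mathlib

open Cardinal Ordinal

universe u

noncomputable section

namespace TreeUnif

/-! ### Weak diamond -/

/-- The set `ω₁` of countable ordinals, with its usual well-order. -/
abbrev Omega1 : Type (u + 1) := Set.Iio (ω₁ : Ordinal.{u})

/-- The weak diamond: for any `F : 2^{<ω₁} → 2` there is `g ∈ 2^{ω₁}` such that for any `f ∈ 2^{ω₁}`
the set `{α ∈ ω₁ : g α ≠ F (f ↾ α)}` is stationary. The map `F` is given by its restrictions to the
sets `2^α`, where `α = {ξ : ξ < α}` is the initial segment `Set.Iio α` of `ω₁`. -/
def WeakDiamond : Prop :=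
  ∀ F : (α : Omega1.{u}) → (Set.Iio α → Fin 2) → Fin 2,
    ∃ g : Omega1.{u} → Fin 2, ∀ f : Omega1.{u} → Fin 2,
      IsStationary {α : Omega1.{u} | g α ≠ F α (fun ξ => f ξ.1)}

/-! ### Trees -/

/-- A partial order is a tree if the set `t↓ = {s : s < t}` is well-ordered for each `t`. -/
class IsTree (T : Type u) [PartialOrder T] : Prop where
  isWellOrder (t : T) : IsWellOrder (Set.Iio t) (· < ·)

attribute [instance] IsTree.isWellOrder

section Tree

variable (T : Type u) [PartialOrder T] [IsTree T]

variable {T} in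
/-- The height of a node `t` is the order type of `t↓`. -/
def height (t : T) : Ordinal.{u} :=
  Ordinal.type (fun a b : Set.Iio t => a < b)

/-- The `α`th level of the tree. -/
def level (α : Ordinal.{u}) : Set T := {t | height t = α}

/-- The height of a tree is the least `α` such that the `α`th level is empty. -/
def treeHeight : Ordinal.{u} := sInf {α | level T α = ∅}

variable {T} in
/-- For `ξ < height t`, the restriction `t ↾ ξ` is the predecessor of `t` of height `ξ`, that is,
the `ξ`th element of the well-ordered set `t↓`. -/
def restrict (t : T) (ξ : Ordinal.{u}) (hξ : ξ < height t) : T :=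
  (Ordinal.enum (fun a b : Set.Iio t => a < b) ⟨ξ, hξ⟩).1

variable {T} in
theorem restrict_lt (t : T) (ξ : Ordinal.{u}) (hξ : ξ < height t) : restrict t ξ hξ < t :=
  (Ordinal.enum (fun a b : Set.Iio t => a < b) ⟨ξ, hξ⟩).2

/-- An `ℵ₁`-tree is a tree of height `ω₁` all of whose levels are countable. -/
structure IsAleph1Tree : Prop where
  treeHeight_eq : treeHeight T = ω₁
  countable_level : ∀ α, (level T α).Countable

/-- All antichains (sets of pairwise incomparable nodes) are countable. -/
def NoUncountableAntichain : Prop :=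
  ∀ A : Set T, IsAntichain (· ≤ ·) A → A.Countable

/-- All chains are countable. -/
def NoUncountableChain : Prop :=
  ∀ A : Set T, IsChain (· ≤ ·) A → A.Countable

/-- A Suslin tree is an `ℵ₁`-tree without uncountable chains and without uncountable antichains. -/
structure IsSuslinTree : Prop where
  isAleph1Tree : IsAleph1Tree T
  noUncountableChain : NoUncountableChain T
  noUncountableAntichain : NoUncountableAntichain T

variable {T} in
/-- A subtree of a tree of height `ω₁`: a nonempty downward closed set `S` which is pruned, that is,
each `s ∈ S` has extensions in `S` of arbitrarily large height below `ω₁`. -/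
structure IsSubtree (S : Set T) : Prop where
  nonempty : S.Nonempty
  isLowerSet : IsLowerSet S
  pruned : ∀ s ∈ S, ∀ β < (ω₁ : Ordinal.{u}), ∃ t ∈ S, s ≤ t ∧ β ≤ height t

end Tree

/-! ### Ladder systems, colourings, uniformizations -/

/-- The set of countable limit ordinals (`0` is not a limit). -/
abbrev LimOmega1 : Type (u + 1) := {α : Ordinal.{u} // α < ω₁ ∧ Order.IsSuccLimit α}

/-- A ladder system on `ω₁`: for each countable limit ordinal `α` a cofinal subset of `α` of order
type `ω`. -/
structure LadderSystem where
  ladder : LimOmega1.{u} → Set Ordinal.{u}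
  lt_of_mem : ∀ α : LimOmega1.{u}, ∀ ξ ∈ ladder α, ξ < α.1
  cofinal : ∀ α, ∀ β < α.1, ∃ ξ ∈ ladder α, β ≤ ξ
  orderType : ∀ α, Nonempty (ℕ ≃o ladder α)

/-- A colouring of the ladder system `C` (with natural numbers as colours): maps `f_α : C_α → ℕ`
for all countable limit ordinals `α`. -/
abbrev Colouring (C : LadderSystem.{u}) : Type (u + 1) :=
  (α : LimOmega1.{u}) → C.ladder α → ℕ

/-- `f` is an `n`-colouring: each `f_α` takes values in `n = {0, …, n - 1}`. -/
def IsNColouring (n : ℕ) {C : LadderSystem.{u}} (f : Colouring C) : Prop :=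
  ∀ α ξ, f α ξ < n

/-- `f` is monochromatic: each `f_α` is constant. -/
def IsMonochromatic {C : LadderSystem.{u}} (f : Colouring C) : Prop :=
  ∀ α, ∃ i : ℕ, ∀ ξ, f α ξ = i

/-- The map `φ` with domain `S ⊆ T` is a `T`-uniformization of `f`: its domain is a subtree, and for
all `s ∈ S` of limit height `α < ω₁` the equality `φ (s ↾ ξ) = f_α ξ` holds for all but finitely many
`ξ ∈ C_α`. -/
structure IsUniformization {T : Type u} [PartialOrder T] [IsTree T] {C : LadderSystem.{u}}
    (f : Colouring C) (S : Set T) (φ : S → ℕ) : Prop where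
  isSubtree : IsSubtree S
  eventually_eq : ∀ (s : T) (hs : s ∈ S) (α : LimOmega1.{u}) (hα : height s = α.1),
    {ξ : C.ladder α |
      φ ⟨restrict s ξ.1 ((C.lt_of_mem α _ ξ.2).trans_eq hα.symm),
        isSubtree.isLowerSet (restrict_lt s ξ.1 _).le hs⟩ ≠ f α ξ}.Finite

/-- The colouring `f` has a `T`-uniformization. -/
def HasUniformization (T : Type u) [PartialOrder T] [IsTree T] {C : LadderSystem.{u}}
    (f : Colouring C) : Prop :=
  ∃ (S : Set T) (φ : S → ℕ), IsUniformization f S φ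

/-- All monochromatic `n`-colourings of `C` have a `T`-uniformization. -/
def UnifMono (n : ℕ) (T : Type u) [PartialOrder T] [IsTree T] (C : LadderSystem.{u}) : Prop :=
  ∀ f : Colouring C, IsNColouring n f → IsMonochromatic f → HasUniformization T f

end TreeUnif

end

/-!
# Weak diamond, cardinal arithmetic, and uniformization on trees

**Weak diamond and `2^ℵ₀ < 2^ℵ₁`** (Devlin and Shelah). If `2^ℵ₁ ≤ 2^ℵ₀`, every `g ∈ 2^ω₁` can be
coded by the first `ω` values of some `f ∈ 2^ω₁`; the map `F` that decodes `g` from `f ↾ α` and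
returns `g α` then refutes the weak diamond (`WeakDiamond.two_power_lt`).

Conversely, let `F` refute the weak diamond: every `g` is predicted on a club by the restrictions of
some `f`. Applied coordinatewise, `F` predicts every map from `ω₁` to the reals from a countable
family of functions. Starting with `h ∈ 2^ω₁`, build countable families `Xₙ` and decreasing clubs
`Cₙ` such that, at each `α ∈ Cₙ₊₁`, the values of `F` at the restrictions of `Xₙ₊₁` to `α` code `γ`
and `Xₙ ↾ γ`, where `γ` is the next element of `Cₙ` above `α`, and such that `Xₙ₊₁` contains `Xₙ`
(`exists_isNextStage`). Suppose that the sequences for `h` and `h'` agree below some `β` lying in all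
the clubs of both. Then they agree below a larger such ordinal, the supremum of the next elements
of the `Cₙ` above `β` (`InStep.exists_gt`); as the set of such ordinals is closed under suprema, the
sequences agree everywhere (`InStep.eq`). So `h` is determined by the `Xₙ ↾ β` for a single
countable `β`, which amounts to a real, and `2^ℵ₁ ≤ 2^ℵ₀` (`weakDiamond_of_two_power_lt`).

**No uniformization.** Let `T` be an `ℵ₁`-tree without uncountable antichains, and let `φ : S → ω`
uniformize a monochromatic 2-colouring with values `c_α`. The minimal nodes outside `S` form an
antichain, so for all large `α` a node of height `α` is in `S` as soon as its predecessors are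
(`NoUncountableAntichain.exists_bound_mem`). Hence `φ` restricted to the nodes of height below `α`
decides `c_α`: it is `1` if and only if some node `s` of height `α` has all predecessors in the
domain and `φ (s ↾ ξ) = 1` for almost all `ξ ∈ C_α` (`IsUniformization.predictsOne_iff`). After
coding `φ` by an element of `2^ω₁` so that, for club many `α`, that restriction is coded below `α`,
the weak diamond yields a sequence `c_α` for which this prediction fails stationarily often
(`WeakDiamond.not_unifMono`). Under CH, `2^ℵ₀ = ℵ₁ < 2^ℵ₁` gives the weak diamond.
-/

namespace TreeUnif

/-! ### Club subsets of `ω₁` -/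

section Clubs

open Order Set

instance : Nonempty Omega1.{u} := ⟨⟨0, omega_pos 1⟩⟩

theorem mk_omega1 : #Omega1.{u} = ℵ₁ := by
  rw [Cardinal.mk_Iio_ordinal, card_omega, lift_aleph, Ordinal.lift_one]

theorem cof_omega1 : Order.cof Omega1.{u} = ℵ₁ := by
  rw [Ordinal.cof_Iio, lift_omega, Ordinal.lift_one, ← ord_aleph, isRegular_aleph_one.cof_ord]

theorem cof_omega1_ne : Order.cof Omega1.{u} ≠ ℵ₀ := by
  rw [cof_omega1]; exact aleph0_lt_aleph_one.ne'

theorem lt_omega_one_iff_card_le {a : Ordinal.{u}} : a < ω₁ ↔ a.card ≤ ℵ₀ := by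
  rw [← ord_aleph, lt_ord, ← succ_aleph0, lt_succ_iff]

theorem countable_Iio_of_lt {a : Ordinal.{u}} (h : a < ω₁) : (Iio a).Countable := by
  rw [← le_aleph0_iff_set_countable, Cardinal.mk_Iio_ordinal, lift_le_aleph0]
  exact lt_omega_one_iff_card_le.1 h

theorem countable_Iio_omega1 (a : Omega1.{u}) : (Iio a).Countable :=
  (countable_Iio_of_lt a.2).preimage Subtype.val_injective

instance : NoMaxOrder Omega1.{u} :=
  ⟨fun a => ⟨⟨succ a.1, (isSuccLimit_omega 1).succ_lt a.2⟩, lt_succ a.1⟩⟩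

theorem bddAbove_of_countable {s : Set Omega1.{u}} (hs : s.Countable) : BddAbove s := by
  refine .of_not_isCofinal fun h => ?_
  have := (cof_le h).trans (le_aleph0_iff_set_countable.2 hs)
  rw [cof_omega1] at this
  exact this.not_gt aleph0_lt_aleph_one

theorem exists_isLUB_of_countable {s : Set Omega1.{u}} (hs : s.Countable) : ∃ a, IsLUB s a := by
  have hb := bddAbove_of_countable hs
  exact ⟨wellFounded_lt.min _ hb, wellFounded_lt.min_mem _ hb,
    fun b hbs => not_lt.1 (wellFounded_lt.not_lt_min (s := upperBounds s) hbs)⟩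

theorem countable_Iic_omega1 (a : Omega1.{u}) : (Iic a).Countable := by
  obtain ⟨b, hb⟩ := exists_gt a
  exact (countable_Iio_omega1 b).mono fun x hx => lt_of_le_of_lt hx hb

theorem isClub_Ioi (a : Omega1.{u}) : IsClub (Ioi a) := by
  refine ⟨fun d hd ⟨x, hx⟩ _ b hb => (hd hx).trans_le (hb.1 hx), fun b => ?_⟩
  obtain ⟨c, hc⟩ := exists_gt (max a b)
  exact ⟨c, (le_max_left a b).trans_lt hc, (le_max_right a b).trans hc.le⟩

/-- Closure points of a function `ω₁ → ω₁` form a club. -/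
theorem isClub_closurePoints (h : Omega1.{u} → Omega1.{u}) :
    IsClub {α : Omega1.{u} | ∀ ξ < α, h ξ < α} := by
  refine ⟨fun d hd hne _ a ha ξ hξ => ?_, fun a => ?_⟩
  · obtain ⟨x, hx, hξx⟩ := (lt_isLUB_iff ha).1 hξ
    exact (hd hx ξ hξx).trans_le (ha.1 hx)
  · have step (x : Omega1.{u}) : ∃ y, x < y ∧ ∀ ξ ≤ x, h ξ < y := by
      obtain ⟨b, hb⟩ := bddAbove_of_countable ((countable_Iic_omega1 x).image h)
      obtain ⟨y, hy⟩ := exists_gt (max x b)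
      exact ⟨y, (le_max_left _ _).trans_lt hy, fun ξ hξ =>
        (hb (mem_image_of_mem h hξ)).trans_lt ((le_max_right _ _).trans_lt hy)⟩
    choose f hf hf' using step
    obtain ⟨b, hb⟩ := exists_isLUB_of_countable (countable_range fun n : ℕ => f^[n] a)
    refine ⟨b, fun ξ hξ => ?_, hb.1 ⟨0, rfl⟩⟩
    obtain ⟨_, ⟨n, rfl⟩, hn⟩ := (lt_isLUB_iff hb).1 hξ
    refine (hf' _ ξ hn.le).trans_le (hb.1 ⟨n + 1, ?_⟩)
    exact Function.iterate_succ_apply' f n a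

/-- The countable limit ordinals form a club. -/
theorem isClub_limits : IsClub {α : Omega1.{u} | IsSuccLimit α.1} := by
  let s : Omega1.{u} → Omega1.{u} := fun a => ⟨succ a.1, (isSuccLimit_omega 1).succ_lt a.2⟩
  have key : {α : Omega1.{u} | IsSuccLimit α.1} =
      {α | ∀ ξ < α, s ξ < α} ∩ Ioi ⟨0, omega_pos 1⟩ := by
    ext α
    constructor
    · exact fun hα => ⟨fun ξ hξ => hα.succ_lt hξ, hα.bot_lt⟩
    · rintro ⟨h, h0⟩
      refine ⟨not_isMin_of_lt (show (0 : Ordinal) < α.1 from h0),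
        isSuccPrelimit_of_succ_lt fun b hb => h ⟨b, lt_trans hb α.2⟩ hb⟩
  rw [key]
  exact (isClub_closurePoints s).inter cof_omega1_ne (isClub_Ioi _)

end Clubs

end TreeUnif

namespace TreeUnif

/-! ### The weak diamond and cardinal arithmetic -/

section WeakDiamondCardinal

open Order Set

theorem mk_omega1_fun : #(Omega1.{u} → Fin 2) = 2 ^ (ℵ₁ : Cardinal.{u + 1}) := by
  simp

/-- The weak diamond fails when `2^ℵ₁ ≤ 2^ℵ₀`: a candidate `g` can be coded in the first `ω` values
of `f`, so `F` can read `g` off and predict it correctly from `ω` on. -/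
theorem WeakDiamond.two_power_lt (hW : WeakDiamond.{u}) :
    (2 : Cardinal.{u}) ^ (ℵ₀ : Cardinal.{u}) < 2 ^ (ℵ₁ : Cardinal.{u}) := by
  by_contra hle
  have hle' : #(Omega1.{u} → Fin 2) ≤ lift.{u + 1} #(ℕ → Fin 2) := by
    have := lift_le.{u + 1}.2 (not_lt.1 hle)
    rw [mk_omega1_fun]
    simpa using this
  obtain ⟨e⟩ := lift_mk_le'.1 ((Cardinal.lift_uzero _).trans_le hle')
  let nat (n : ℕ) : Omega1.{u} := ⟨n, (natCast_lt_omega0 n).trans omega0_lt_omega_one⟩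
  have hnat : Function.Injective nat := fun m n h =>
    Nat.cast_injective (congrArg Subtype.val h)
  obtain ⟨g, hg⟩ := hW fun α p =>
    (Function.invFun e fun n => if h : nat n < α then p ⟨nat n, h⟩ else 0 : Omega1.{u} → Fin 2) α
  obtain ⟨α, hα, hωα⟩ := hg (Function.extend nat (e g) 0)
    (isClub_Ioi ⟨ω, omega0_lt_omega_one⟩)
  refine hα ?_
  have hlt (n : ℕ) : nat n < α := lt_trans (natCast_lt_omega0 n) hωα
  simp only [hlt, dite_true, hnat.extend_apply]
  rw [Function.leftInverse_invFun e.injective]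

/-- Countably many restrictions to a common countable ordinal of functions in `2^ω₁`. -/
abbrev Approx : Type (u + 1) := Σ γ : Omega1.{u}, ℕ → Iio γ → Fin 2

/-- The restriction of a countable family of functions to `γ`, as an `Approx`. -/
def approx (γ : Omega1.{u}) (X : ℕ → Omega1.{u} → Fin 2) : Approx.{u} :=
  ⟨γ, fun k ξ => X k ξ⟩

/-- Two countable families of functions on `ω₁` have the same restrictions to `β`. -/
def AgreeBelow (β : Omega1.{u}) (X Y : ℕ → Omega1.{u} → Fin 2) : Prop :=
  ∀ k, ∀ ξ < β, X k ξ = Y k ξ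

theorem agreeBelow_of_approx_eq {γ γ' : Omega1.{u}} {X Y : ℕ → Omega1.{u} → Fin 2}
    (h : approx γ X = approx γ' Y) : γ = γ' ∧ AgreeBelow γ X Y := by
  obtain ⟨h1, h2⟩ := Sigma.mk.inj_iff.1 h
  subst h1
  exact ⟨rfl, fun k ξ hξ => congrFun (congrFun (eq_of_heq h2) k) ⟨ξ, hξ⟩⟩

theorem mk_approx_le : #Approx.{u} ≤ 2 ^ (ℵ₀ : Cardinal.{u + 1}) := by
  have h (γ : Omega1.{u}) : #(ℕ → Iio γ → Fin 2) ≤ 2 ^ (ℵ₀ : Cardinal.{u + 1}) := by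
    have hγ : #(Iio γ) ≤ ℵ₀ := le_aleph0_iff_set_countable.2 (countable_Iio_omega1 γ)
    calc #(ℕ → Iio γ → Fin 2) = (2 ^ #(Iio γ)) ^ (ℵ₀ : Cardinal.{u + 1}) := by simp
      _ = 2 ^ (#(Iio γ) * ℵ₀) := (power_mul ..).symm
      _ ≤ 2 ^ (ℵ₀ * ℵ₀ : Cardinal.{u + 1}) :=
        power_le_power_left two_ne_zero (mul_le_mul_left hγ _)
      _ = 2 ^ (ℵ₀ : Cardinal.{u + 1}) := by rw [aleph0_mul_aleph0]
  calc #Approx.{u} = Cardinal.sum fun γ : Omega1.{u} => #(ℕ → Iio γ → Fin 2) := mk_sigma _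
    _ ≤ Cardinal.sum fun _ : Omega1.{u} => 2 ^ (ℵ₀ : Cardinal.{u + 1}) := sum_le_sum _ _ h
    _ = ℵ₁ * 2 ^ ℵ₀ := by rw [sum_const', mk_omega1]
    _ ≤ 2 ^ ℵ₀ * 2 ^ ℵ₀ := by
      gcongr
      rw [← succ_aleph0]
      exact succ_le_of_lt (cantor _)
    _ = 2 ^ ℵ₀ := by rw [← power_add, aleph0_add_aleph0]

theorem _root_.IsClub.exists_next {C : Set Omega1.{u}} (hC : IsClub C) (α : Omega1.{u}) :
    ∃ γ, IsLeast (C ∩ Ioi α) γ := by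
  have hne := (hC.inter cof_omega1_ne (isClub_Ioi α)).nonempty
  exact ⟨wellFounded_lt.min _ hne, wellFounded_lt.min_mem _ hne,
    fun b hb => not_lt.1 (wellFounded_lt.not_lt_min (s := C ∩ Ioi α) hb)⟩

/-- A countable family of functions on `ω₁` together with a club. -/
abbrev Stage : Type (u + 1) :=
  (ℕ → Omega1.{u} → Fin 2) × {C : Set Omega1.{u} // IsClub C}

/-- `t` is a successor stage of `s`, relative to a function `F` on `2^{<ω₁}` and a coding of
approximations by reals: the family of `t` contains that of `s` (at the even indices), and at each
`α` in the smaller club of `t` the values of `F` at the restrictions to `α` of the odd-indexed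
functions of `t` code the restrictions of the functions of `s` to the next element of the club
of `s`. -/
structure IsNextStage (F : (α : Omega1.{u}) → (Iio α → Fin 2) → Fin 2)
    (code : Approx.{u} → ℕ → Fin 2) (s t : Stage.{u}) : Prop where
  subset : t.2.1 ⊆ s.2.1
  even : ∀ k, t.1 (2 * k) = s.1 k
  code_eq : ∀ α ∈ t.2.1, ∀ γ, IsLeast (s.2.1 ∩ Ioi α) γ →
    ∀ j, code (approx γ s.1) j = F α fun ξ => t.1 (2 * j + 1) ξ

theorem exists_isNextStage {F : (α : Omega1.{u}) → (Iio α → Fin 2) → Fin 2}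
    (hF : ∀ g : Omega1.{u} → Fin 2, ∃ f : Omega1.{u} → Fin 2, ∃ C, IsClub C ∧
      ∀ α ∈ C, g α = F α fun ξ => f ξ)
    (code : Approx.{u} → ℕ → Fin 2) (s : Stage.{u}) : ∃ t, IsNextStage F code s t := by
  choose next hnext using s.2.2.exists_next
  choose Y C hC hY using fun j : ℕ => hF fun α => code (approx (next α) s.1) j
  refine ⟨⟨fun k => if Even k then s.1 (k / 2) else Y (k / 2), (⋂ j, C j) ∩ s.2.1,
    (IsClub.iInter_of_countable cof_omega1_ne hC).inter cof_omega1_ne s.2.2⟩,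
    inter_subset_right, fun k => ?_, fun α hα γ hγ j => ?_⟩
  · simp
  · rw [hγ.unique (hnext α), hY j α (mem_iInter.1 hα.1 j)]
    have h1 : ¬ Even (2 * j + 1) := by simp
    have h2 : (2 * j + 1) / 2 = j := by omega
    simp only [h1, if_false, h2]

section Sequences

variable {F : (α : Omega1.{u}) → (Iio α → Fin 2) → Fin 2} {code : Approx.{u} → ℕ → Fin 2}
  {s t : ℕ → Stage.{u}}

theorem stage_antitone (hs : ∀ n, IsNextStage F code (s n) (s (n + 1))) :
    Antitone fun n => (s n).2.1 :=
  antitone_nat_of_succ_le fun n => (hs n).subset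

theorem AgreeBelow.of_le_stage {β : Omega1.{u}}
    (hs : ∀ n, IsNextStage F code (s n) (s (n + 1)))
    (ht : ∀ n, IsNextStage F code (t n) (t (n + 1))) {m n : ℕ} (hmn : m ≤ n)
    (h : AgreeBelow β (s n).1 (t n).1) : AgreeBelow β (s m).1 (t m).1 := by
  induction n, hmn using Nat.le_induction with
  | base => exact h
  | succ n _ ih =>
    refine ih fun k ξ hξ => ?_
    rw [← (hs n).even, ← (ht n).even]
    exact h _ ξ hξ

/-- Two sequences of stages are in step at `β` if `β` belongs to all their clubs and the
corresponding families have the same restrictions to `β`. -/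
def InStep (s t : ℕ → Stage.{u}) (β : Omega1.{u}) : Prop :=
  ∀ n, β ∈ (s n).2.1 ∧ β ∈ (t n).2.1 ∧ AgreeBelow β (s n).1 (t n).1

/-- If `γₙ` is the next element of the `n`-th club above `β`, then `F` forces agreement of the
`n`-th families up to `γₙ`. The `γₙ` increase with `n`, so their supremum lies in all the clubs, and
as later families contain the earlier ones, all families agree up to it. -/
theorem InStep.exists_gt (hcode : Function.Injective code)
    (hs : ∀ n, IsNextStage F code (s n) (s (n + 1)))
    (ht : ∀ n, IsNextStage F code (t n) (t (n + 1))) {β : Omega1.{u}} (h : InStep s t β) :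
    ∃ β' > β, InStep s t β' := by
  choose γ hγ using fun n => (s n).2.2.exists_next β
  choose γ' hγ' using fun n => (t n).2.2.exists_next β
  have key (n : ℕ) : γ n = γ' n ∧ AgreeBelow (γ n) (s n).1 (t n).1 := by
    refine agreeBelow_of_approx_eq (hcode (funext fun j => ?_))
    rw [(hs n).code_eq β (h (n + 1)).1 _ (hγ n), (ht n).code_eq β (h (n + 1)).2.1 _ (hγ' n)]
    congr 1
    exact funext fun ξ => (h (n + 1)).2.2 _ _ ξ.2
  have hmono : Monotone γ := monotone_nat_of_le_succ fun n =>
    (hγ n).2 ⟨(hs n).subset (hγ (n + 1)).1.1, (hγ (n + 1)).1.2⟩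
  obtain ⟨δ, hδ⟩ := exists_isLUB_of_countable (countable_range γ)
  have hδ' (n : ℕ) : IsLUB (range fun m => γ (n + m)) δ := by
    refine ⟨?_, fun b hb => hδ.2 ?_⟩ <;> rintro _ ⟨m, rfl⟩
    · exact hδ.1 ⟨_, rfl⟩
    · exact (hmono (Nat.le_add_left m n)).trans (hb ⟨m, rfl⟩)
  refine ⟨δ, (hγ 0).1.2.trans_le (hδ.1 ⟨0, rfl⟩), fun n => ⟨?_, ?_, fun k ξ hξ => ?_⟩⟩
  · refine (s n).2.2.isLUB_mem ?_ (range_nonempty _) (hδ' n)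
    rintro _ ⟨m, rfl⟩
    exact stage_antitone hs (Nat.le_add_right n m) (hγ _).1.1
  · refine (t n).2.2.isLUB_mem ?_ (range_nonempty _) (hδ' n)
    rintro _ ⟨m, rfl⟩
    simp only [(key _).1]
    exact stage_antitone ht (Nat.le_add_right n m) (hγ' _).1.1
  · obtain ⟨_, ⟨m, rfl⟩, hm⟩ := (lt_isLUB_iff (hδ' n)).1 hξ
    exact AgreeBelow.of_le_stage hs ht (Nat.le_add_right n m) (key _).2 k ξ hm

theorem InStep.eq (hcode : Function.Injective code)
    (hs : ∀ n, IsNextStage F code (s n) (s (n + 1)))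
    (ht : ∀ n, IsNextStage F code (t n) (t (n + 1))) {β : Omega1.{u}} (h : InStep s t β) :
    (s 0).1 = (t 0).1 := by
  funext k ξ
  by_contra hne
  have hbound : ∀ b ∈ {b | InStep s t b}, b ≤ ξ := fun b hb =>
    not_lt.1 fun hlt => hne ((hb 0).2.2 k ξ hlt)
  obtain ⟨δ, hδ⟩ := exists_isLUB_of_countable
    ((countable_Iic_omega1 ξ).mono (s₁ := {b | InStep s t b}) hbound)
  have hin : InStep s t δ := fun n =>
    ⟨(s n).2.2.isLUB_mem (fun b hb => (hb n).1) ⟨β, h⟩ hδ,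
      (t n).2.2.isLUB_mem (fun b hb => (hb n).2.1) ⟨β, h⟩ hδ, fun k' ζ hζ => by
        obtain ⟨b, hb, hζb⟩ := (lt_isLUB_iff hδ).1 hζ
        exact (hb n).2.2 k' ζ hζb⟩
  obtain ⟨δ', hlt, hδ'⟩ := hin.exists_gt hcode hs ht
  exact hlt.not_ge (hδ.1 hδ')

end Sequences

/-- If the weak diamond fails, then `h ∈ 2^ω₁` is determined by the restrictions to a countable
ordinal of countably many functions, namely those in a sequence of stages that starts with `h`. -/
theorem weakDiamond_of_two_power_lt
    (hlt : (2 : Cardinal.{u}) ^ (ℵ₀ : Cardinal.{u}) < 2 ^ (ℵ₁ : Cardinal.{u})) :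
    WeakDiamond.{u} := by
  by_contra hW
  simp only [WeakDiamond, not_forall, not_exists, not_isStationary_iff] at hW
  obtain ⟨F, hF⟩ := hW
  have hF' (g : Omega1.{u} → Fin 2) : ∃ f : Omega1.{u} → Fin 2, ∃ C, IsClub C ∧
      ∀ α ∈ C, g α = F α fun ξ => f ξ := by
    obtain ⟨f, C, hC, hd⟩ := hF g
    exact ⟨f, C, hC, fun α hα => by_contra fun hne => disjoint_left.1 hd hne hα⟩
  obtain ⟨code⟩ : Nonempty (Approx.{u} ↪ (ℕ → Fin 2)) := by
    refine lift_mk_le'.1 ((Cardinal.lift_uzero _).trans_le (mk_approx_le.trans ?_))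
    simp
  choose next hnext using exists_isNextStage hF' code
  let seq (h : Omega1.{u} → Fin 2) (n : ℕ) : Stage.{u} := next^[n] ⟨fun _ => h, univ, .univ⟩
  have hseq (h : Omega1.{u} → Fin 2) (n : ℕ) : IsNextStage F code (seq h n) (seq h (n + 1)) := by
    simp only [seq, Function.iterate_succ_apply']
    exact hnext _
  have hbase (h : Omega1.{u} → Fin 2) : ∃ β, ∀ n, β ∈ (seq h n).2.1 := by
    simpa using (IsClub.iInter_of_countable cof_omega1_ne fun n => (seq h n).2.2).nonempty
  choose base hbase using hbase
  have hinj : Function.Injective fun h =>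
      approx (base h) fun k => (seq h k.unpair.1).1 k.unpair.2 := by
    intro h h' heq
    obtain ⟨h1, h2⟩ := agreeBelow_of_approx_eq heq
    refine congrFun (InStep.eq (β := base h) code.injective (hseq h) (hseq h') fun n =>
      ⟨hbase h n, h1 ▸ hbase h' n, fun k ξ hξ => ?_⟩) 0
    simpa using h2 (Nat.pair n k) ξ hξ
  have hle := (mk_le_of_injective hinj).trans mk_approx_le
  rw [mk_omega1_fun] at hle
  refine hlt.not_ge (lift_le.{u + 1}.1 ?_)
  simpa using hle

theorem weakDiamond_iff : WeakDiamond.{u} ↔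
    (2 : Cardinal.{u}) ^ (ℵ₀ : Cardinal.{u}) < 2 ^ (ℵ₁ : Cardinal.{u}) :=
  ⟨WeakDiamond.two_power_lt, weakDiamond_of_two_power_lt⟩

end WeakDiamondCardinal

end TreeUnif

namespace TreeUnif

/-! ### Heights and subtrees -/

section Trees

open Order Set

variable {T : Type u} [PartialOrder T] [IsTree T]

theorem height_eq_typein {t : T} (a : Iio t) :
    height a.1 = typein (fun a b : Iio t => a < b) a := by
  rw [← type_subrel]
  refine Ordinal.type_eq.2 ⟨⟨⟨fun x => ⟨⟨x.1, lt_trans x.2 a.2⟩, x.2⟩, fun x => ⟨x.1.1, x.2⟩,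
    fun _ => rfl, fun _ => rfl⟩, Iff.rfl⟩⟩

theorem height_restrict (t : T) (ξ : Ordinal.{u}) (hξ : ξ < height t) :
    height (restrict t ξ hξ) = ξ := by
  rw [restrict, height_eq_typein]
  exact typein_enum _ hξ

theorem height_lt_height {s t : T} (h : s < t) : height s < height t := by
  rw [height_eq_typein (⟨s, h⟩ : Iio t)]
  exact typein_lt_type _ _

theorem exists_le_height_eq {t : T} {ξ : Ordinal.{u}} (h : ξ ≤ height t) :
    ∃ s ≤ t, height s = ξ := by
  obtain rfl | h := h.eq_or_lt
  · exact ⟨t, le_rfl, rfl⟩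
  · exact ⟨_, (restrict_lt t ξ h).le, height_restrict t ξ h⟩

theorem IsAleph1Tree.height_lt (hT : IsAleph1Tree T) (t : T) : height t < ω₁ := by
  by_contra! hlt
  have hne : {α | level T α = ∅}.Nonempty := by
    by_contra! h
    have h0 := hT.treeHeight_eq
    rw [treeHeight, h, Ordinal.sInf_empty] at h0
    exact (omega_pos 1).ne h0
  have hmem : level T ω₁ = ∅ := by
    have := csInf_mem hne
    rwa [← treeHeight, hT.treeHeight_eq] at this
  obtain ⟨s, -, hs⟩ := exists_le_height_eq hlt
  exact (hmem ▸ hs : s ∈ (∅ : Set T))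

/-- The nodes of an `ℵ₁`-tree can be coded, together with natural numbers, by countable ordinals. -/
theorem IsAleph1Tree.nonempty_embedding (hT : IsAleph1Tree T) :
    Nonempty (T × ℕ ↪ Omega1.{u}) := by
  choose idx hidx using fun α => countable_iff_exists_injOn.1 (hT.countable_level α)
  have hinj : Function.Injective fun x : T × ℕ =>
      ((⟨height x.1, hT.height_lt x.1⟩, idx (height x.1) x.1, x.2) : Omega1.{u} × ℕ × ℕ) := by
    rintro ⟨s, m⟩ ⟨t, n⟩ h
    simp only [Prod.mk.injEq] at h
    obtain ⟨h1, h2, rfl⟩ := h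
    replace h1 : height s = height t := congrArg Subtype.val h1
    rw [h1] at h2
    rw [hidx _ (show s ∈ level T (height t) from h1) rfl h2]
  have hcard : #(Omega1.{u} × ℕ × ℕ) = #Omega1.{u} := by
    simp only [mk_prod, mk_omega1, mk_nat, lift_aleph0, aleph0_mul_aleph0, Cardinal.lift_id,
      Cardinal.lift_uzero]
    rw [mul_eq_left aleph0_lt_aleph_one.le aleph0_lt_aleph_one.le aleph0_ne_zero]
  obtain ⟨i⟩ := Cardinal.eq.1 hcard
  exact ⟨⟨_, i.injective.comp hinj⟩⟩

/-- The nodes outside `S` all of whose predecessors are in `S` form an antichain. So in the absence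
of uncountable antichains their heights are bounded, and above the bound a node belongs to `S` as
soon as all its predecessors do. -/
theorem NoUncountableAntichain.exists_bound_mem (hA : NoUncountableAntichain T)
    (hT : IsAleph1Tree T)
    (S : Set T) :
    ∃ β : Omega1.{u}, ∀ t : T, β.1 < height t → (∀ s < t, s ∈ S) → t ∈ S := by
  have hanti : IsAntichain (· ≤ ·) {t | t ∉ S ∧ ∀ s < t, s ∈ S} :=
    fun s hs t ht hne hle => hs.1 (ht.2 s (hle.lt_of_ne hne))
  obtain ⟨β, hβ⟩ := bddAbove_of_countable
    ((hA _ hanti).image fun t => (⟨height t, hT.height_lt t⟩ : Omega1.{u}))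
  refine ⟨β, fun t ht hS => by_contra fun htS => ?_⟩
  exact ht.not_ge (hβ (mem_image_of_mem _ ⟨htS, hS⟩))

theorem IsSubtree.exists_height_eq {S : Set T} (hS : IsSubtree S) {α : Ordinal.{u}}
    (hα : α < ω₁) : ∃ s ∈ S, height s = α := by
  obtain ⟨s, hs⟩ := hS.nonempty
  obtain ⟨t, ht, -, hle⟩ := hS.pruned s hs α hα
  obtain ⟨r, hr, hrα⟩ := exists_le_height_eq hle
  exact ⟨r, hS.isLowerSet hr ht, hrα⟩

end Trees

/-! ### A colouring without uniformization -/

section NoUniformization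

open Order Set

variable {T : Type u} [PartialOrder T] [IsTree T] {C : LadderSystem.{u}}

/-- Let `q t n` say that a partial function from `T` to `ω` takes the value `n` at `t`. Then
`PredictsOne C α q` says that some node `s` of height `α` has all its predecessors in the domain,
and that the value at `s ↾ ξ` is `1` for almost all `ξ ∈ C_α`. Only the values at nodes of height
below `α` matter. -/
def PredictsOne (C : LadderSystem.{u}) (α : LimOmega1.{u}) (q : T → ℕ → Prop) : Prop :=
  ∃ s : T, ∃ hs : height s = α.1, (∀ t < s, ∃ n, q t n) ∧
    {ξ : C.ladder α | ¬ q (restrict s ξ.1 ((C.lt_of_mem α _ ξ.2).trans_eq hs.symm)) 1}.Finite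

theorem predictsOne_congr {α : LimOmega1.{u}} {q q' : T → ℕ → Prop}
    (h : ∀ t n, height t < α.1 → (q t n ↔ q' t n)) :
    PredictsOne C α q ↔ PredictsOne C α q' := by
  refine exists_congr fun s => exists_congr fun hs => and_congr ?_ ?_
  · refine forall₂_congr fun t ht => exists_congr fun n => h t n ?_
    exact hs ▸ height_lt_height ht
  · simp only [h _ 1 (hs ▸ height_lt_height (restrict_lt s _ _))]

/-- Let `f` be uniformized on `S` by `φ`, with `f_α` of constant value `c`. If `α` is so large that
a node of height `α` belongs to `S` once all its predecessors do, then `φ` restricted to the nodes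
of height below `α` decides whether `c = 1`. -/
theorem IsUniformization.predictsOne_iff {f : Colouring C} {S : Set T} {φ : S → ℕ}
    (hφ : IsUniformization f S φ) {α : LimOmega1.{u}}
    (hα : ∀ t : T, height t = α.1 → (∀ s < t, s ∈ S) → t ∈ S) {c : ℕ} (hc : ∀ ξ, f α ξ = c) :
    PredictsOne C α (fun t n => ∃ ht : t ∈ S, φ ⟨t, ht⟩ = n) ↔ c = 1 := by
  constructor
  · rintro ⟨s, hs, hpred, hfin⟩
    have hsS : s ∈ S := hα s hs fun t ht => (hpred t ht).choose_spec.1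
    obtain ⟨e⟩ := C.orderType α
    have : Infinite (C.ladder α) := .of_injective e e.injective
    obtain ⟨ξ, hξ⟩ := (hfin.union (hφ.eventually_eq s hsS α hs)).exists_notMem
    simp only [mem_union, mem_ofPred_eq, not_or, not_not, hc] at hξ
    obtain ⟨⟨_, h1⟩, h2⟩ := hξ
    exact h2.symm.trans h1
  · rintro rfl
    obtain ⟨s, hsS, hs⟩ := hφ.isSubtree.exists_height_eq α.2.1
    refine ⟨s, hs, fun t ht => ⟨_, hφ.isSubtree.isLowerSet ht.le hsS, rfl⟩, ?_⟩
    refine (hφ.eventually_eq s hsS α hs).subset fun ξ hξ heq => hξ ?_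
    exact ⟨_, heq.trans (hc ξ)⟩

theorem WeakDiamond.not_unifMono (hW : WeakDiamond.{u}) (hT : IsAleph1Tree T)
    (hA : NoUncountableAntichain T) (C : LadderSystem.{u}) : ¬ UnifMono 2 T C := by
  classical
  intro hU
  obtain ⟨e⟩ := hT.nonempty_embedding
  -- `F` reads `p ∈ 2^α` as the set of codes of a partial function on the nodes below level `α`.
  obtain ⟨g, hg⟩ := hW fun α p =>
    if h : IsSuccLimit α.1 then
      if PredictsOne (T := T) C ⟨α.1, α.2, h⟩ (fun t n => ∃ hlt : e (t, n) < α, p ⟨_, hlt⟩ = 1)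
      then 1 else 0
    else 0
  obtain ⟨S, φ, hφ⟩ := hU (fun α _ => (g ⟨α.1, α.2.1⟩ : ℕ)) (fun α _ => (g _).isLt)
    fun α => ⟨_, fun _ => rfl⟩
  obtain ⟨β, hβ⟩ := hA.exists_bound_mem hT S
  -- `h ξ` bounds the codes attached to the countably many nodes of height `ξ`.
  have hbound (ξ : Omega1.{u}) : ∃ b, ∀ t n, height t = ξ.1 → e (t, n) ≤ b := by
    obtain ⟨b, hb⟩ := bddAbove_of_countable
      (((hT.countable_level ξ.1).prod (countable_univ (α := ℕ))).image e)
    exact ⟨b, fun t n ht => hb (mem_image_of_mem e ⟨ht, mem_univ _⟩)⟩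
  choose h hh using hbound
  let q (t : T) (n : ℕ) : Prop := ∃ ht : t ∈ S, φ ⟨t, ht⟩ = n
  obtain ⟨α, hne, ⟨hlim, hcl⟩, hβα⟩ :=
    hg (fun x => if ∃ t n, e (t, n) = x ∧ q t n then 1 else 0)
      ((isClub_limits.inter cof_omega1_ne (isClub_closurePoints h)).inter cof_omega1_ne
        (isClub_Ioi β))
  have hlim' : IsSuccLimit α.1 := hlim
  have hcongr := predictsOne_congr (C := C) (α := ⟨α.1, α.2, hlim'⟩)
    (q := fun t n => ∃ _ : e (t, n) < α,
      (if ∃ t' n', e (t', n') = e (t, n) ∧ q t' n' then 1 else 0 : Fin 2) = 1) (q' := q) <| by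
    intro t n ht
    have hlt : e (t, n) < α :=
      (hh ⟨height t, hT.height_lt t⟩ t n rfl).trans_lt (hcl _ ht)
    simp [hlt]
  have hiff := hφ.predictsOne_iff (α := ⟨α.1, α.2, hlim'⟩) (c := (g α : ℕ))
    (fun t ht => hβ t (ht ▸ hβα)) fun _ => rfl
  refine hne ?_
  simp only [hlim', dite_true, hcongr.trans hiff]
  generalize g α = x
  fin_cases x <;> simp

end NoUniformization

theorem two_power_aleph0_lt_of_ch (h : (2 : Cardinal.{u}) ^ (ℵ₀ : Cardinal.{u}) = ℵ₁) :
    (2 : Cardinal.{u}) ^ (ℵ₀ : Cardinal.{u}) < 2 ^ (ℵ₁ : Cardinal.{u}) :=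
  h.trans_lt (cantor _)

end TreeUnif

theorem theorem2p3 :
    (TreeUnif.WeakDiamond.{u} ↔
      (2 : Cardinal.{u}) ^ (ℵ₀ : Cardinal.{u}) < 2 ^ (ℵ₁ : Cardinal.{u})) ∧
    (TreeUnif.WeakDiamond.{u} →
      ∀ (T : Type u) [PartialOrder T] [TreeUnif.IsTree T],
        TreeUnif.IsAleph1Tree T → TreeUnif.NoUncountableAntichain T →
          ∀ C : TreeUnif.LadderSystem.{u}, ¬ TreeUnif.UnifMono 2 T C) ∧
    ((2 : Cardinal.{u}) ^ (ℵ₀ : Cardinal.{u}) = ℵ₁ →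
      ∀ (T : Type u) [PartialOrder T] [TreeUnif.IsTree T],
        TreeUnif.IsSuslinTree T →
          ∀ C : TreeUnif.LadderSystem.{u}, ¬ TreeUnif.UnifMono 2 T C) := by
  exact ⟨TreeUnif.weakDiamond_iff, fun hW T _ _ hT hA C => hW.not_unifMono hT hA C,
    fun hCH T _ _ hT C => (TreeUnif.weakDiamond_iff.2
      (TreeUnif.two_power_aleph0_lt_of_ch hCH)).not_unifMono
        hT.isAleph1Tree hT.noUncountableAntichain C⟩
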